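/- **Corollary (Stirling series).** For $j\ge 1$ put $a_j=\frac1{j+2}$, and for integers $m,r\ge 0$ let $$a_m^{(r)}=\sum_{\substack{n_1+\cdots+n_r=m\\ n_i\ge 1}}a_{n_1}a_{n_2}\cdots a_{n_r}$$ be the partial ordinary Bell polynomial in $a_1,a_2,\dots$, that is, the sum of all ordered products of $r$ terms of $a_1,a_2,\dots$ whose subscripts add to $m$; in particular $a_0^{(0)}=1$ and $a_m^{(0)}=0$ for $m\ge1$. With the convention $(-1)!!=1$, put $$c_j=\sum_{r=0}^{2j}\frac{(-1)^r}{r!}\,(2j+2r-1)!!\;a_{2j}^{(r)}\qquad(j\ge 0).$$ Then Stirling's series is $$k!\;\sim\;k^k e^{-k}\sqrt{2\pi k}\;\sum_{j=0}^{\infty}c_j\,k^{-j},\qquad k\to\infty,$$ as an asymptotic expansion: for every integer $N\ge 0$, $$k!=k^k e^{-k}\sqrt{2\pi k}\,\Bigl(\sum_{j=0}^{N}c_j\,k^{-j}+o(k^{-N})\Bigr),\qquad k\to\infty.$$ This holds both as $k\to\infty$ through the positive integers and as $k\to\infty$ through the positive reals, where $k!=\Gamma(k+1)$. -/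

import Mathlib

open scoped Nat

/-- The partial ordinary Bell polynomial `a_m^{(r)}` of a sequence `a 1, a 2, …`: the sum of
`a (n 0) * ⋯ * a (n (r-1))` over all tuples of positive integers with `n 0 + ⋯ + n (r-1) = m`.
For `r = 0` there is only the empty tuple, so the value is `1` if `m = 0` and `0` otherwise. -/
def partialBell (a : ℕ → ℝ) (m r : ℕ) : ℝ :=
  ∑ n ∈ (Finset.Nat.antidiagonalTuple r m).filter (fun n => ∀ i, 1 ≤ n i), ∏ i, a (n i)

/-- The double factorial `(2n - 1)!!`, with `(-1)!! = 1`. -/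
def oddDoubleFactorial : ℕ → ℕ
  | 0 => 1
  | n + 1 => (2 * n + 1)‼

/-- The sequence `a_j = 1 / (j + 2)`. -/
noncomputable def stirlingA (j : ℕ) : ℝ := 1 / ((j : ℝ) + 2)

/-- The coefficient of `k^{-j}`: `∑_{r=0}^{2j} ((-1)^r / r!) (2j + 2r - 1)!! a_{2j}^{(r)}`. -/
noncomputable def stirlingCoeff (j : ℕ) : ℝ :=
  ∑ r ∈ Finset.range (2 * j + 1),
    (-1 : ℝ) ^ r / (r ! : ℝ) * (oddDoubleFactorial (j + r) : ℝ) * partialBell stirlingA (2 * j) r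

/-- `u ∼ p · ∑_{j ≥ 0} c_j k^{-j}` along the filter `l`, as an asymptotic expansion in the sense of
Poincaré: for every `N`, the partial sum up to `j = N` has error `o(p k^{-N})`. -/
def HasAsymptoticSeries {α : Type*} (l : Filter α) (u p k : α → ℝ) (c : ℕ → ℝ) : Prop :=
  ∀ N : ℕ, Asymptotics.IsLittleO l
    (fun x => u x - p x * ∑ j ∈ Finset.range (N + 1), ((k x) ^ j)⁻¹ * c j)
    (fun x => p x * ((k x) ^ N)⁻¹)

/-! Laplace's method with explicit error control. Substituting `t = k + √k u` in the Gamma integral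
and writing `ε = 1/√k`, `s = ε u`, the phase is `s - log (1 + s) = s²/2 + s² h(-s)`, where `h(y)`
has expansion `∑ y^j/(j+2)` over `j ≥ 1`. The integrand becomes `exp(-u²/2) exp(-u² h(-εu))`.
Expanding the second factor in `r` and then `h^r` in powers of `y` produces the Bell polynomials
(`partialBell_eq_coeff`). Integrating against the Gaussian kills odd powers of `ε`, and even ones
give the double factorials (`integral_gaussianApprox`). The analytic core is
`exists_abs_gammaIntegrand_sub_le`: the expansion to order `n` has error `O(ε^n)` uniformly in `u`,
with an integrable weight. Taking `n = 2N + 1` gives `O(k^{-N-1/2})`, hence `o(k^{-N})`. -/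

open Filter Topology Asymptotics MeasureTheory

/-! ### Bell polynomials as coefficients of powers of a series -/

/-- The power series `∑_{j ≥ 1} a_j X^j`. -/
noncomputable def bellSeries (a : ℕ → ℝ) : PowerSeries ℝ :=
  PowerSeries.mk fun j => if j = 0 then 0 else a j

/-- The zero constant term kills every tuple with a zero entry, so the positivity filter can be
dropped. -/
theorem partialBell_eq_sum_antidiagonalTuple (a : ℕ → ℝ) (m r : ℕ) :
    partialBell a m r =
      ∑ n ∈ Finset.Nat.antidiagonalTuple r m, ∏ i, PowerSeries.coeff (n i) (bellSeries a) := by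
  unfold partialBell
  rw [Finset.sum_filter]
  refine Finset.sum_congr rfl fun n _ => ?_
  split_ifs with h
  · refine Finset.prod_congr rfl fun i _ => ?_
    have := h i
    simp [bellSeries, show n i ≠ 0 by omega]
  · push Not at h
    obtain ⟨i, hi⟩ := h
    exact (Finset.prod_eq_zero (Finset.mem_univ i)
      (by simp [bellSeries, show n i = 0 by omega])).symm

theorem sum_antidiagonalTuple_prod_coeff (A : PowerSeries ℝ) (m r : ℕ) :
    ∑ n ∈ Finset.Nat.antidiagonalTuple r m, ∏ i, PowerSeries.coeff (n i) A =
      PowerSeries.coeff m (A ^ r) := by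
  induction r generalizing m with
  | zero => cases m <;> simp [PowerSeries.coeff_one]
  | succ r ih =>
    rw [pow_succ', PowerSeries.coeff_mul]
    simp_rw [← ih, Finset.mul_sum]
    rw [Finset.sum_sigma']
    refine Finset.sum_bij' (fun n _ => ⟨(n 0, ∑ i, Fin.tail n i), Fin.tail n⟩)
      (fun p _ => Fin.cons p.1.1 p.2) ?_ ?_ ?_ ?_ ?_
    · intro n hn
      rw [Finset.Nat.mem_antidiagonalTuple, Fin.sum_univ_succ] at hn
      simpa [Finset.Nat.mem_antidiagonalTuple, Fin.tail] using hn
    · rintro ⟨⟨i, j⟩, n⟩ hn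
      rw [Finset.mem_sigma, Finset.Nat.mem_antidiagonalTuple,
        Finset.HasAntidiagonal.mem_antidiagonal] at hn
      simp only [Finset.Nat.mem_antidiagonalTuple]
      rw [Fin.sum_cons, hn.2, hn.1]
    · intro n _
      simp
    · rintro ⟨⟨i, j⟩, n⟩ hn
      simp only [Finset.mem_sigma, Finset.Nat.mem_antidiagonalTuple] at hn
      simp [hn.2]
    · intro n _
      simp [Fin.prod_univ_succ, Fin.tail]

theorem partialBell_eq_coeff (a : ℕ → ℝ) (m r : ℕ) :
    partialBell a m r = PowerSeries.coeff m (bellSeries a ^ r) := by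
  rw [partialBell_eq_sum_antidiagonalTuple, sum_antidiagonalTuple_prod_coeff]

theorem partialBell_eq_zero_of_lt (a : ℕ → ℝ) {m r : ℕ} (h : m < r) : partialBell a m r = 0 := by
  unfold partialBell
  rw [Finset.filter_false_of_mem, Finset.sum_empty]
  intro n hn h1
  rw [Finset.Nat.mem_antidiagonalTuple] at hn
  have := Finset.sum_le_sum fun i (_ : i ∈ Finset.univ) => h1 i
  simp at this
  omega

/-! ### Expansions at the origin: powers and exponentials -/

theorem eval_trunc (A : PowerSeries ℝ) (n : ℕ) (y : ℝ) :
    (PowerSeries.trunc n A).eval y = ∑ m ∈ Finset.range n, PowerSeries.coeff m A * y ^ m := by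
  induction n with
  | zero => simp
  | succ n ih => rw [PowerSeries.trunc_succ, Polynomial.eval_add, ih, Finset.sum_range_succ,
      Polynomial.eval_monomial]

theorem isBigO_eval_one (p : Polynomial ℝ) :
    (fun y => p.eval y) =O[𝓝 0] (fun _ => (1 : ℝ)) :=
  p.continuous.continuousAt.tendsto.isBigO_one ℝ

theorem isBigO_eval_sub_eval_trunc (p : Polynomial ℝ) (n : ℕ) :
    (fun y => p.eval y - (PowerSeries.trunc n (p : PowerSeries ℝ)).eval y)
      =O[𝓝 0] (fun y : ℝ => y ^ n) := by
  have : Polynomial.X ^ n ∣ p - PowerSeries.trunc n (p : PowerSeries ℝ) := by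
    rw [Polynomial.X_pow_dvd_iff]
    intro d hd
    simp [PowerSeries.coeff_trunc, hd]
  obtain ⟨q, hq⟩ := this
  have h : (fun y => p.eval y - (PowerSeries.trunc n (p : PowerSeries ℝ)).eval y) =
      fun y => y ^ n * q.eval y := by
    ext y
    rw [← Polynomial.eval_sub, hq]
    simp
  rw [h]
  simpa using (isBigO_refl (fun y : ℝ => y ^ n) (𝓝 0)).mul (isBigO_eval_one q)

/-- An asymptotic expansion at `0` may be raised to a power. -/
theorem isBigO_pow_sub_trunc {h : ℝ → ℝ} {A : PowerSeries ℝ} {n : ℕ}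
    (H : (fun y => h y - (PowerSeries.trunc n A).eval y) =O[𝓝 0] (fun y : ℝ => y ^ n)) (r : ℕ) :
    (fun y => h y ^ r - (PowerSeries.trunc n (A ^ r)).eval y) =O[𝓝 0] (fun y : ℝ => y ^ n) := by
  have hn : (fun y : ℝ => y ^ n) =O[𝓝 0] (fun _ => (1 : ℝ)) :=
    (continuous_pow n).continuousAt.tendsto.isBigO_one ℝ
  have h1 : h =O[𝓝 0] (fun _ => (1 : ℝ)) := by
    simpa using (H.trans hn).add (isBigO_eval_one (PowerSeries.trunc n A))
  have key : (fun y => h y ^ r - (PowerSeries.trunc n A).eval y ^ r)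
      =O[𝓝 0] (fun y : ℝ => y ^ n) := by
    induction r with
    | zero => simpa using isBigO_zero _ _
    | succ r ih =>
      -- With `T` the truncation, `h^(r+1) - T^(r+1) = (h - T) h^r + T (h^r - T^r)`.
      have q1 : (fun y => (h y - (PowerSeries.trunc n A).eval y) * h y ^ r)
          =O[𝓝 0] (fun y : ℝ => y ^ n) := by simpa using H.mul (h1.pow r)
      have q2 : (fun y => (PowerSeries.trunc n A).eval y *
          (h y ^ r - (PowerSeries.trunc n A).eval y ^ r)) =O[𝓝 0] (fun y : ℝ => y ^ n) := by
        simpa using (isBigO_eval_one (PowerSeries.trunc n A)).mul ih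
      exact (q1.add q2).congr_left fun y => by ring
  have := key.add (isBigO_eval_sub_eval_trunc (PowerSeries.trunc n A ^ r) n)
  refine this.congr_left fun y => ?_
  rw [Polynomial.coe_pow, PowerSeries.trunc_trunc_pow, Polynomial.eval_pow]
  ring

theorem abs_exp_sub_sum_le (z : ℝ) (n : ℕ) :
    |Real.exp z - ∑ r ∈ Finset.range n, z ^ r / (r ! : ℝ)| ≤ |z| ^ n * Real.exp |z| := by
  have := Complex.norm_exp_sub_sum_le_norm_mul_exp (z : ℂ) n
  rw [Complex.norm_real, Real.norm_eq_abs] at this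
  rw [← Real.norm_eq_abs, ← Complex.norm_real]
  push_cast
  exact this

/-- The expansion of `exp (-u² h(y))` in powers of `y`, truncated below `y ^ n`. -/
noncomputable def expExpansion (A : PowerSeries ℝ) (n : ℕ) (y u : ℝ) : ℝ :=
  ∑ r ∈ Finset.range n, (-u ^ 2) ^ r / (r ! : ℝ) * (PowerSeries.trunc n (A ^ r)).eval y

/-- As `A` has no constant term, `h = O(y)`. This makes the exponential remainder `O(y^n)` and, for
small `y`, gives `|h y| ≤ 1/4`, so the growth `exp(u²/4)` can be absorbed by `exp(-u²/2)`. -/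
theorem exists_abs_exp_sub_expExpansion_le {h : ℝ → ℝ} {A : PowerSeries ℝ} {n : ℕ} (hn : 0 < n)
    (hA : PowerSeries.coeff 0 A = 0)
    (H : (fun y => h y - (PowerSeries.trunc n A).eval y) =O[𝓝 0] (fun y : ℝ => y ^ n)) :
    ∃ δ > 0, ∃ C ≥ 0, ∀ y u : ℝ, |y| ≤ δ →
      |Real.exp (-u ^ 2 * h y) - expExpansion A n y u| ≤
        C * |y| ^ n * (1 + u ^ 2) ^ n * Real.exp (u ^ 2 / 4) := by
  have hlin : h =O[𝓝 0] (fun y : ℝ => y) := by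
    have h1 : (fun y : ℝ => y ^ n) =O[𝓝 0] (fun y : ℝ => y) := by
      refine IsBigO.of_bound 1 ?_
      filter_upwards [Metric.ball_mem_nhds (0 : ℝ) one_pos] with y hy
      rw [norm_pow, one_mul]
      exact pow_le_of_le_one (norm_nonneg y) (mem_ball_zero_iff.1 hy).le hn.ne'
    have h2 : (fun y => (PowerSeries.trunc n A).eval y) =O[𝓝 0] (fun y : ℝ => y) := by
      have : Polynomial.X ∣ PowerSeries.trunc n A := by
        rw [Polynomial.X_dvd_iff, PowerSeries.coeff_trunc, if_pos hn, hA]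
      obtain ⟨q, hq⟩ := this
      simp only [hq, Polynomial.eval_mul, Polynomial.eval_X]
      simpa using (isBigO_refl (fun y : ℝ => y) (𝓝 0)).mul (isBigO_eval_one q)
    simpa using (H.trans h1).add h2
  obtain ⟨C₁, hC₁, hb₁⟩ := hlin.exists_pos
  choose D hD hbD using fun r => (isBigO_pow_sub_trunc H r).exists_pos
  have hall : ∀ᶠ y in 𝓝 (0 : ℝ), ‖h y‖ ≤ C₁ * ‖y‖ ∧ C₁ * ‖y‖ ≤ 1 / 4 ∧
      ∀ r ∈ Finset.range n, ‖h y ^ r - (PowerSeries.trunc n (A ^ r)).eval y‖ ≤ D r * ‖y ^ n‖ := by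
    refine hb₁.bound.and (Filter.Eventually.and ?_ ?_)
    · have : Tendsto (fun y : ℝ => C₁ * ‖y‖) (𝓝 0) (𝓝 0) := by
        have : Continuous fun y : ℝ => C₁ * ‖y‖ := by fun_prop
        simpa using this.tendsto 0
      exact this.eventually_le_const (by norm_num)
    · exact (Filter.eventually_all_finset _).2 fun r _ => (hbD r).bound
  obtain ⟨δ, hδ, hball⟩ := Metric.nhds_basis_closedBall.eventually_iff.1 hall
  refine ⟨δ, hδ, C₁ ^ n + ∑ r ∈ Finset.range n, D r, ?_, fun y u hy => ?_⟩
  · have := Finset.sum_nonneg fun r (_ : r ∈ Finset.range n) => (hD r).le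
    positivity
  obtain ⟨b1, b2, b3⟩ := hball (show y ∈ Metric.closedBall 0 δ by simpa using hy)
  simp only [Real.norm_eq_abs, abs_pow] at b1 b2 b3
  have hu : (0 : ℝ) ≤ u ^ 2 := sq_nonneg u
  have hz : |-u ^ 2 * h y| = u ^ 2 * |h y| := by rw [abs_mul, abs_neg, abs_of_nonneg hu]
  have e1 : |Real.exp (-u ^ 2 * h y) - ∑ r ∈ Finset.range n, (-u ^ 2 * h y) ^ r / (r ! : ℝ)| ≤
      C₁ ^ n * |y| ^ n * (1 + u ^ 2) ^ n * Real.exp (u ^ 2 / 4) := by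
    refine (abs_exp_sub_sum_le _ n).trans ?_
    rw [hz]
    have : u ^ 2 * |h y| ≤ u ^ 2 / 4 := by nlinarith
    have h3 : u ^ 2 * |h y| ≤ (1 + u ^ 2) * (C₁ * |y|) := by gcongr; linarith
    calc (u ^ 2 * |h y|) ^ n * Real.exp (u ^ 2 * |h y|)
        ≤ ((1 + u ^ 2) * (C₁ * |y|)) ^ n * Real.exp (u ^ 2 / 4) := by gcongr
      _ = _ := by rw [mul_pow, mul_pow]; ring
  have e2 : |∑ r ∈ Finset.range n, (-u ^ 2 * h y) ^ r / (r ! : ℝ) - expExpansion A n y u| ≤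
      (∑ r ∈ Finset.range n, D r) * |y| ^ n * (1 + u ^ 2) ^ n * Real.exp (u ^ 2 / 4) := by
    rw [expExpansion, ← Finset.sum_sub_distrib]
    refine (Finset.abs_sum_le_sum_abs _ _).trans ?_
    simp_rw [Finset.sum_mul]
    refine Finset.sum_le_sum fun r hr => ?_
    have hrn : r ≤ n := (Finset.mem_range.1 hr).le
    have hfac : (1 : ℝ) ≤ r ! := by exact_mod_cast Nat.succ_le_of_lt (Nat.factorial_pos r)
    have : (-u ^ 2 * h y) ^ r / (r ! : ℝ) -
        (-u ^ 2) ^ r / (r ! : ℝ) * (PowerSeries.trunc n (A ^ r)).eval y =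
        (-u ^ 2) ^ r / (r ! : ℝ) * (h y ^ r - (PowerSeries.trunc n (A ^ r)).eval y) := by
      rw [mul_pow]; ring
    rw [this, abs_mul, abs_div, abs_pow, abs_neg, abs_of_nonneg hu,
      abs_of_pos (by positivity : (0 : ℝ) < r !)]
    have q1 : (u ^ 2) ^ r / (r ! : ℝ) ≤ (1 + u ^ 2) ^ n :=
      calc (u ^ 2) ^ r / (r ! : ℝ) ≤ (u ^ 2) ^ r := div_le_self (by positivity) hfac
        _ ≤ (1 + u ^ 2) ^ r := by gcongr; linarith
        _ ≤ (1 + u ^ 2) ^ n := pow_le_pow_right₀ (by linarith) hrn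
    have q2 : 1 ≤ Real.exp (u ^ 2 / 4) := Real.one_le_exp (by positivity)
    have hDr := hD r
    calc (u ^ 2) ^ r / (r ! : ℝ) * |h y ^ r - (PowerSeries.trunc n (A ^ r)).eval y|
        ≤ (1 + u ^ 2) ^ n * (D r * |y| ^ n) := by gcongr; exact b3 r hr
      _ = D r * |y| ^ n * (1 + u ^ 2) ^ n * 1 := by ring
      _ ≤ _ := by gcongr
  calc _ ≤ _ := abs_sub_le _ (∑ r ∈ Finset.range n, (-u ^ 2 * h y) ^ r / (r ! : ℝ)) _
    _ ≤ _ := add_le_add e1 e2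
    _ = _ := by ring

/-! ### The phase at the saddle point -/

/-- The phase `s - log (1 + s)` of the Gamma integral around its saddle point. -/
noncomputable def gammaPhase (s : ℝ) : ℝ := s - Real.log (1 + s)

/-- This is `log x ≤ x - 1` at `x = √(1 + s)`. -/
theorem sq_sqrt_sub_one_le_gammaPhase {s : ℝ} (hs : -1 < s) :
    (√(1 + s) - 1) ^ 2 ≤ gammaPhase s := by
  have h0 : 0 < 1 + s := by linarith
  have h1 := Real.log_le_sub_one_of_pos (Real.sqrt_pos.2 h0)
  rw [Real.log_sqrt h0.le] at h1
  have h2 := Real.sq_sqrt h0.le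
  unfold gammaPhase
  nlinarith

theorem sq_div_six_le_gammaPhase {s : ℝ} (hs : -1 < s) (hs1 : s ≤ 1) :
    s ^ 2 / 6 ≤ gammaPhase s := by
  refine le_trans ?_ (sq_sqrt_sub_one_le_gammaPhase hs)
  have h0 : 0 ≤ √(1 + s) := Real.sqrt_nonneg _
  have h2 := Real.sq_sqrt (show 0 ≤ 1 + s by linarith)
  have h3 : √(1 + s) ≤ 1.42 := Real.sqrt_le_iff.2 ⟨by norm_num, by norm_num; linarith⟩
  have h4 : s = (√(1 + s) - 1) * (√(1 + s) + 1) := by linarith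
  have h5 : (√(1 + s) + 1) ^ 2 ≤ 6 := by nlinarith
  have : s ^ 2 = (√(1 + s) - 1) ^ 2 * (√(1 + s) + 1) ^ 2 := by rw [← mul_pow, ← h4]
  nlinarith [sq_nonneg (√(1 + s) - 1)]

theorem div_six_le_gammaPhase {s : ℝ} (hs : 1 ≤ s) : s / 6 ≤ gammaPhase s := by
  refine le_trans ?_ (sq_sqrt_sub_one_le_gammaPhase (by linarith))
  have h0 : 0 ≤ √(1 + s) := Real.sqrt_nonneg _
  have h2 := Real.sq_sqrt (show 0 ≤ 1 + s by linarith)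
  -- With `x = √(1 + s)`, the bound `(x² - 1)/6 ≤ (x - 1)²` for `x > 1` amounts to `x ≥ 7/5`.
  have h3 : 1.4 ≤ √(1 + s) := Real.le_sqrt_of_sq_le (by norm_num; linarith)
  nlinarith

/-- The part of `(s - log (1 + s)) / s²` of positive order, as a function of `y = -s`. -/
noncomputable def gammaPhaseTail (y : ℝ) : ℝ :=
  if y = 0 then 0 else gammaPhase (-y) / y ^ 2 - 1 / 2

theorem gammaPhase_eq (s : ℝ) : gammaPhase s = s ^ 2 / 2 + s ^ 2 * gammaPhaseTail (-s) := by
  rcases eq_or_ne s 0 with rfl | hs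
  · simp [gammaPhase]
  · simp only [gammaPhaseTail, neg_eq_zero, hs, if_false, neg_neg, neg_sq]
    field_simp
    ring

theorem isBigO_gammaPhaseTail_sub_trunc {n : ℕ} (hn : 0 < n) :
    (fun y => gammaPhaseTail y - (PowerSeries.trunc n (bellSeries stirlingA)).eval y)
      =O[𝓝 0] (fun y : ℝ => y ^ n) := by
  obtain ⟨n, rfl⟩ : ∃ k, n = k + 1 := ⟨n - 1, by omega⟩
  refine IsBigO.of_bound 2 ?_
  filter_upwards [Metric.closedBall_mem_nhds (0 : ℝ) (show (0 : ℝ) < 1 / 2 by norm_num)] with y hy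
  have hy' : |y| ≤ 1 / 2 := by simpa using hy
  have hT : (PowerSeries.trunc (n + 1) (bellSeries stirlingA)).eval y =
      ∑ i ∈ Finset.range n, y ^ (i + 1) / ((i : ℝ) + 3) := by
    rw [eval_trunc, Finset.sum_range_succ']
    simp only [bellSeries, PowerSeries.coeff_mk, Nat.add_eq_zero_iff, one_ne_zero, and_false,
      if_false, if_true, zero_mul, add_zero, stirlingA]
    refine Finset.sum_congr rfl fun i _ => ?_
    push_cast
    rw [one_div_mul_eq_div, add_assoc]
    norm_num
  rw [hT]
  rcases eq_or_ne y 0 with rfl | h0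
  · simp [gammaPhaseTail]
  -- Two extra terms, since dividing by `y²` costs two orders.
  have hlog := Real.abs_log_sub_add_sum_range_le (show |y| < 1 by linarith) (n + 2)
  have hden : |y| ^ (n + 2 + 1) / (1 - |y|) ≤ 2 * |y| ^ (n + 3) := by
    rw [div_le_iff₀ (by linarith)]
    have : 0 ≤ |y| ^ (n + 3) := by positivity
    nlinarith
  have hsum : (∑ i ∈ Finset.range (n + 2), y ^ (i + 1) / ((i : ℝ) + 1)) =
      y + y ^ 2 / 2 + y ^ 2 * ∑ i ∈ Finset.range n, y ^ (i + 1) / ((i : ℝ) + 3) := by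
    rw [Finset.sum_range_succ', Finset.sum_range_succ', Finset.mul_sum]
    have : ∀ i ∈ Finset.range n, y ^ (i + 1 + 1 + 1) / (((i + 1 + 1 : ℕ) : ℝ) + 1) =
        y ^ 2 * (y ^ (i + 1) / ((i : ℝ) + 3)) := fun i _ => by
      push_cast
      rw [show (i : ℝ) + 1 + 1 + 1 = i + 3 by ring]
      ring
    rw [Finset.sum_congr rfl this]
    norm_num
    ring
  rw [hsum] at hlog
  have hy2 : 0 < y ^ 2 := by positivity
  have hkey : y ^ 2 * (gammaPhaseTail y - ∑ i ∈ Finset.range n, y ^ (i + 1) / ((i : ℝ) + 3)) =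
      -(y + y ^ 2 / 2 + y ^ 2 * (∑ i ∈ Finset.range n, y ^ (i + 1) / ((i : ℝ) + 3)) +
        Real.log (1 - y)) := by
    simp only [gammaPhaseTail, h0, if_false, gammaPhase, ← sub_eq_add_neg]
    field_simp
    ring
  have h4 := hlog.trans hden
  rw [← abs_neg, ← hkey, abs_mul, abs_of_pos hy2, ← sq_abs] at h4
  have hpos : 0 < |y| ^ 2 := by positivity
  rw [Real.norm_eq_abs, Real.norm_eq_abs, abs_pow]
  refine le_of_mul_le_mul_left (h4.trans (le_of_eq ?_)) hpos
  ring

/-! ### Uniform approximation of the rescaled integrand -/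

/-- The Gamma integrand, rescaled around its saddle point: `exp (-(s - log (1 + s)) / ε²)` at
`s = ε u`. -/
noncomputable def gammaIntegrand (ε u : ℝ) : ℝ :=
  if -1 < ε * u then Real.exp (-(gammaPhase (ε * u) / ε ^ 2)) else 0

theorem measurable_gammaIntegrand (ε : ℝ) : Measurable (gammaIntegrand ε) := by
  unfold gammaIntegrand gammaPhase
  refine Measurable.ite (measurableSet_lt (by fun_prop) (by fun_prop)) ?_ measurable_const
  have : Measurable fun u : ℝ => Real.log (1 + ε * u) := Real.measurable_log.comp (by fun_prop)
  fun_prop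

theorem gammaIntegrand_eq {ε u : ℝ} (hε : 0 < ε) (h : -1 < ε * u) :
    gammaIntegrand ε u =
      Real.exp (-(u ^ 2 / 2)) * Real.exp (-u ^ 2 * gammaPhaseTail (-(ε * u))) := by
  rw [gammaIntegrand, if_pos h, gammaPhase_eq, ← Real.exp_add]
  congr 1
  field_simp
  ring

theorem abs_div_six_sub_one_le (u : ℝ) : |u| / 6 - 1 ≤ u ^ 2 / 6 := by
  nlinarith [sq_abs u, sq_nonneg (|u| - 1)]

theorem gammaIntegrand_nonneg (ε u : ℝ) : 0 ≤ gammaIntegrand ε u := by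
  unfold gammaIntegrand
  split_ifs
  exacts [(Real.exp_pos _).le, le_rfl]

/-- A majorant independent of `ε`: the quadratic phase bound serves for `ε u ≤ 1`; beyond, the
linear one gives `u/(6ε) ≥ u/6`. -/
theorem gammaIntegrand_le {ε u : ℝ} (hε : 0 < ε) (hε1 : ε ≤ 1) :
    gammaIntegrand ε u ≤ Real.exp (1 - |u| / 6) := by
  unfold gammaIntegrand
  split_ifs with h
  · rw [Real.exp_le_exp]
    have : |u| / 6 - 1 ≤ gammaPhase (ε * u) / ε ^ 2 := by
      rcases le_total (ε * u) 1 with h1 | h1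
      · refine (abs_div_six_sub_one_le u).trans ?_
        rw [le_div_iff₀ (by positivity)]
        refine le_trans (le_of_eq ?_) (sq_div_six_le_gammaPhase h h1)
        ring
      · have hu : 0 < u := by
          by_contra! hu
          nlinarith
        rw [le_div_iff₀ (by positivity), abs_of_pos hu]
        refine le_trans ?_ (div_six_le_gammaPhase h1)
        nlinarith [mul_pos hε hu, mul_nonneg (mul_pos hε hu).le (sub_nonneg.2 hε1), sq_nonneg ε]
    linarith
  · exact (Real.exp_pos _).le

/-- Away from the origin, `|y|/δ ≥ 1` raises each lower power of `y` to the `n`-th. -/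
theorem exists_abs_expExpansion_le (A : PowerSeries ℝ) (n : ℕ) {δ : ℝ} (hδ : 0 < δ)
    (hδ1 : δ ≤ 1) :
    ∃ C ≥ 0, ∀ y u : ℝ, δ ≤ |y| → |expExpansion A n y u| ≤ C * |y| ^ n * (1 + u ^ 2) ^ n := by
  refine ⟨∑ r ∈ Finset.range n, ∑ m ∈ Finset.range n,
    |PowerSeries.coeff m (A ^ r)| / δ ^ n, by positivity, fun y u hy => ?_⟩
  unfold expExpansion
  refine (Finset.abs_sum_le_sum_abs _ _).trans ?_
  rw [Finset.sum_mul, Finset.sum_mul]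
  refine Finset.sum_le_sum fun r hr => ?_
  have hrn : r ≤ n := (Finset.mem_range.1 hr).le
  have hfac : (1 : ℝ) ≤ r ! := by exact_mod_cast Nat.succ_le_of_lt (Nat.factorial_pos r)
  rw [abs_mul, abs_div, abs_pow, abs_neg, abs_of_nonneg (sq_nonneg u),
    abs_of_pos (by positivity : (0 : ℝ) < r !), mul_comm]
  have hu := sq_nonneg u
  have q1 : (u ^ 2) ^ r / (r ! : ℝ) ≤ (1 + u ^ 2) ^ n :=
    calc (u ^ 2) ^ r / (r ! : ℝ) ≤ (u ^ 2) ^ r := div_le_self (by positivity) hfac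
      _ ≤ (1 + u ^ 2) ^ r := by gcongr; linarith
      _ ≤ (1 + u ^ 2) ^ n := pow_le_pow_right₀ (by linarith) hrn
  have q2 : |(PowerSeries.trunc n (A ^ r)).eval y| ≤
      (∑ m ∈ Finset.range n, |PowerSeries.coeff m (A ^ r)| / δ ^ n) * |y| ^ n := by
    rw [eval_trunc, Finset.sum_mul]
    refine (Finset.abs_sum_le_sum_abs _ _).trans (Finset.sum_le_sum fun m hm => ?_)
    have hmn : m ≤ n := (Finset.mem_range.1 hm).le
    rw [abs_mul, abs_pow, div_mul_eq_mul_div, mul_div_assoc, ← div_pow]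
    refine mul_le_mul_of_nonneg_left ?_ (abs_nonneg _)
    calc |y| ^ m ≤ (|y| / δ) ^ m := by
          gcongr
          exact le_div_self (abs_nonneg y) hδ hδ1
      _ ≤ (|y| / δ) ^ n := pow_le_pow_right₀ ((one_le_div hδ).2 hy) hmn
  exact mul_le_mul q2 q1 (by positivity) (by positivity)

theorem exists_pow_mul_exp_neg_abs_le (n : ℕ) :
    ∃ K ≥ 0, ∀ u : ℝ, |u| ^ n * (1 + u ^ 2) ^ n * Real.exp (1 - |u| / 6) ≤
      K * (1 + u ^ 2)⁻¹ := by
  -- The exponent is `n + 2n + 2`, the degree of the polynomial factor times `1 + u²`; `7/6` is `(1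
  -- + |u|)/6 + (1 - |u|/6)`.
  refine ⟨6 ^ (3 * n + 2) * (3 * n + 2)! * Real.exp (7 / 6), by positivity, fun u => ?_⟩
  have h1 := Real.pow_div_factorial_le_exp _ (show 0 ≤ (1 + |u|) / 6 by positivity) (3 * n + 2)
  rw [div_le_iff₀ (by positivity), div_pow, div_le_iff₀ (by positivity)] at h1
  have h2 : |u| ^ n * (1 + u ^ 2) ^ n * (1 + u ^ 2) ≤ (1 + |u|) ^ (3 * n + 2) := by
    have e1 : |u| ≤ 1 + |u| := by linarith
    have e2 : 1 + u ^ 2 ≤ (1 + |u|) ^ 2 := by nlinarith [sq_abs u, abs_nonneg u]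
    calc |u| ^ n * (1 + u ^ 2) ^ n * (1 + u ^ 2)
        ≤ (1 + |u|) ^ n * ((1 + |u|) ^ 2) ^ n * (1 + |u|) ^ 2 := by gcongr
      _ = _ := by rw [← pow_mul, ← pow_add, ← pow_add]; congr 1; ring
  have h3 : Real.exp ((1 + |u|) / 6) * Real.exp (1 - |u| / 6) = Real.exp (7 / 6) := by
    rw [← Real.exp_add]; congr 1; ring
  rw [← div_eq_mul_inv, le_div_iff₀ (by positivity)]
  calc |u| ^ n * (1 + u ^ 2) ^ n * Real.exp (1 - |u| / 6) * (1 + u ^ 2)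
      = |u| ^ n * (1 + u ^ 2) ^ n * (1 + u ^ 2) * Real.exp (1 - |u| / 6) := by ring
    _ ≤ Real.exp ((1 + |u|) / 6) * (3 * n + 2)! * 6 ^ (3 * n + 2) *
        Real.exp (1 - |u| / 6) := by
        exact mul_le_mul_of_nonneg_right (h2.trans h1) (Real.exp_pos _).le
    _ = 6 ^ (3 * n + 2) * (3 * n + 2)! *
        (Real.exp ((1 + |u|) / 6) * Real.exp (1 - |u| / 6)) := by ring
    _ = _ := by rw [h3]

/-- The Gaussian approximation of the rescaled Gamma integrand, to order `ε ^ n`. -/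
noncomputable def gaussianApprox (n : ℕ) (ε u : ℝ) : ℝ :=
  Real.exp (-(u ^ 2 / 2)) * expExpansion (bellSeries stirlingA) n (-(ε * u)) u

/-- Near the saddle, `|ε u| ≤ δ`, the local expansion applies. Outside, the two terms are bounded
separately, the factor `ε^n` coming from `ε|u|/δ ≥ 1`. -/
theorem exists_abs_gammaIntegrand_sub_le {n : ℕ} (hn : 0 < n) :
    ∃ C ≥ 0, ∀ ε u : ℝ, 0 < ε → ε ≤ 1 →
      |gammaIntegrand ε u - gaussianApprox n ε u| ≤ C * ε ^ n * (1 + u ^ 2)⁻¹ := by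
  obtain ⟨δ', hδ', C₁, hC₁, h₁⟩ := exists_abs_exp_sub_expExpansion_le hn (by simp [bellSeries])
    (isBigO_gammaPhaseTail_sub_trunc hn)
  set δ := min δ' (1 / 2)
  have hδ : 0 < δ := lt_min hδ' (by norm_num)
  have hδ1 : δ ≤ 1 / 2 := min_le_right _ _
  obtain ⟨C₂, hC₂, h₂⟩ := exists_abs_expExpansion_le (bellSeries stirlingA) n hδ (by linarith)
  obtain ⟨K, hK, hb⟩ := exists_pow_mul_exp_neg_abs_le n
  refine ⟨(C₁ + C₂ + 1 / δ ^ n) * K, by positivity, fun ε u hε hε1 => ?_⟩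
  have hw : |gammaIntegrand ε u - gaussianApprox n ε u| ≤
      (C₁ + C₂ + 1 / δ ^ n) * ε ^ n *
        (|u| ^ n * (1 + u ^ 2) ^ n * Real.exp (1 - |u| / 6)) := by
    have hy : |-(ε * u)| = ε * |u| := by rw [abs_neg, abs_mul, abs_of_pos hε]
    have hu := sq_nonneg u
    have hlow := abs_div_six_sub_one_le u
    rcases le_total |-(ε * u)| δ with hle | hge
    · have hx : -1 < ε * u := by
        have := (abs_le.1 (hle.trans hδ1)).2
        linarith
      rw [gammaIntegrand_eq hε hx, gaussianApprox, ← mul_sub, abs_mul,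
        abs_of_pos (Real.exp_pos _)]
      calc _ ≤ Real.exp (-(u ^ 2 / 2)) *
            (C₁ * |-(ε * u)| ^ n * (1 + u ^ 2) ^ n * Real.exp (u ^ 2 / 4)) := by
            gcongr
            exact h₁ _ _ (hle.trans (min_le_left _ _))
        _ = C₁ * ε ^ n * (|u| ^ n * (1 + u ^ 2) ^ n *
            Real.exp (-(u ^ 2 / 2) + u ^ 2 / 4)) := by
            rw [hy, mul_pow, Real.exp_add]; ring
        _ ≤ _ := by
            gcongr
            · have : 0 ≤ 1 / δ ^ n := by positivity
              linarith
            · linarith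
    · have e1 : |gammaIntegrand ε u| ≤ 1 / δ ^ n * ε ^ n *
          (|u| ^ n * (1 + u ^ 2) ^ n * Real.exp (1 - |u| / 6)) := by
        rw [abs_of_nonneg (gammaIntegrand_nonneg _ _)]
        have f1 : 1 ≤ (ε * |u| / δ) ^ n := one_le_pow₀ ((one_le_div hδ).2 (hy ▸ hge))
        have f2 : 1 ≤ (1 + u ^ 2) ^ n := one_le_pow₀ (by linarith)
        calc gammaIntegrand ε u ≤ 1 * 1 * Real.exp (1 - |u| / 6) := by
              simpa using gammaIntegrand_le hε hε1
          _ ≤ (ε * |u| / δ) ^ n * (1 + u ^ 2) ^ n * Real.exp (1 - |u| / 6) := by gcongr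
          _ = _ := by rw [div_pow, mul_pow]; ring
      have e2 : |gaussianApprox n ε u| ≤ C₂ * ε ^ n *
          (|u| ^ n * (1 + u ^ 2) ^ n * Real.exp (1 - |u| / 6)) := by
        rw [gaussianApprox, abs_mul, abs_of_pos (Real.exp_pos _)]
        calc _ ≤ Real.exp (1 - |u| / 6) * (C₂ * |-(ε * u)| ^ n * (1 + u ^ 2) ^ n) := by
              gcongr
              · linarith
              · exact h₂ _ _ hge
          _ = _ := by rw [hy, mul_pow]; ring
      refine (abs_sub _ _).trans ((add_le_add e1 e2).trans ?_)
      rw [← add_mul, ← add_mul]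
      exact mul_le_mul_of_nonneg_right
        (mul_le_mul_of_nonneg_right (by linarith) (by positivity)) (by positivity)
  calc _ ≤ _ := hw
    _ ≤ (C₁ + C₂ + 1 / δ ^ n) * ε ^ n * (K * (1 + u ^ 2)⁻¹) :=
        mul_le_mul_of_nonneg_left (hb u) (by positivity)
    _ = _ := by ring

/-! ### Gaussian moments and the coefficients -/

theorem integrable_pow_mul_exp_neg_sq_div_two (m : ℕ) :
    Integrable fun u : ℝ => u ^ m * Real.exp (-(u ^ 2 / 2)) := by
  have := integrable_rpow_mul_exp_neg_mul_sq (b := 1 / 2) (by norm_num)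
    (show (-1 : ℝ) < (m : ℝ) by linarith [(Nat.cast_nonneg m : (0 : ℝ) ≤ m)])
  refine this.congr (Eventually.of_forall fun u => ?_)
  simp only [Real.rpow_natCast]
  congr 2
  ring

theorem integral_odd_pow_mul_exp_neg_sq_div_two {m : ℕ} (hm : Odd m) :
    ∫ u : ℝ, u ^ m * Real.exp (-(u ^ 2 / 2)) = 0 := by
  have h := integral_neg_eq_self (fun u : ℝ => u ^ m * Real.exp (-(u ^ 2 / 2))) volume
  simp only [hm.neg_pow, neg_sq, neg_mul, integral_neg] at h
  linarith

/-- At `j = 0` truncated subtraction gives `0‼ = 1`, matching `(-1)!! = 1`. -/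
theorem oddDoubleFactorial_eq (j : ℕ) : oddDoubleFactorial j = (2 * j - 1)‼ := by
  cases j <;> simp [oddDoubleFactorial, Nat.mul_add]

theorem integral_even_pow_mul_exp_neg_sq_div_two (j : ℕ) :
    ∫ u : ℝ, u ^ (2 * j) * Real.exp (-(u ^ 2 / 2)) =
      √(2 * Real.pi) * (oddDoubleFactorial j : ℝ) := by
  have h1 := integral_comp_abs (f := fun u : ℝ => u ^ (2 * j) * Real.exp (-(u ^ 2 / 2)))
  simp only [(even_two_mul j).pow_abs, sq_abs] at h1
  have h2 := integral_rpow_mul_exp_neg_mul_rpow (p := 2) (q := (2 * j : ℕ)) (b := 1 / 2)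
    (by norm_num) (by linarith [(Nat.cast_nonneg (2 * j) : (0 : ℝ) ≤ (2 * j : ℕ))]) (by norm_num)
  have h3 : ∀ u : ℝ, u ^ ((2 * j : ℕ) : ℝ) * Real.exp (-(1 / 2) * u ^ (2 : ℝ)) =
      u ^ (2 * j) * Real.exp (-(u ^ 2 / 2)) := fun u => by
    rw [Real.rpow_natCast, Real.rpow_two]
    congr 2
    ring
  simp only [h3] at h2
  have h4 : (((2 * j : ℕ) : ℝ) + 1) / 2 = j + 1 / 2 := by push_cast; ring
  have h5 : (1 / 2 : ℝ) ^ (-(((2 * j : ℕ) : ℝ) + 1) / 2) = 2 ^ j * √2 := by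
    rw [neg_div, h4, one_div, Real.inv_rpow (by norm_num), Real.rpow_neg (by norm_num), inv_inv,
      Real.rpow_add (by norm_num), Real.rpow_natCast, ← one_div, ← Real.sqrt_eq_rpow]
  rw [h1, h2, h4, h5, Real.Gamma_nat_add_half, oddDoubleFactorial_eq,
    Real.sqrt_mul (by norm_num)]
  field_simp

theorem gaussianApprox_eq (n : ℕ) (ε u : ℝ) :
    gaussianApprox n ε u = ∑ r ∈ Finset.range n, ∑ m ∈ Finset.range n,
      ((-1) ^ r / (r ! : ℝ) * partialBell stirlingA m r * (-ε) ^ m) *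
        (u ^ (m + 2 * r) * Real.exp (-(u ^ 2 / 2))) := by
  simp only [gaussianApprox, expExpansion, eval_trunc, Finset.mul_sum, ← partialBell_eq_coeff]
  refine Finset.sum_congr rfl fun r _ => Finset.sum_congr rfl fun m _ => ?_
  rw [neg_pow (u ^ 2), ← neg_mul, mul_pow]
  ring

theorem integrable_gaussianApprox (n : ℕ) (ε : ℝ) : Integrable (gaussianApprox n ε) := by
  have : gaussianApprox n ε = fun u => _ := funext (gaussianApprox_eq n ε)
  rw [this]
  exact integrable_finsetSum _ fun r _ => integrable_finsetSum _ fun m _ =>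
    (integrable_pow_mul_exp_neg_sq_div_two _).const_mul _

theorem integral_gaussianApprox (N : ℕ) (ε : ℝ) :
    ∫ u, gaussianApprox (2 * N + 1) ε u =
      √(2 * Real.pi) * ∑ j ∈ Finset.range (N + 1), (ε ^ 2) ^ j * stirlingCoeff j := by
  simp only [gaussianApprox_eq]
  rw [integral_finsetSum _ fun r _ => integrable_finsetSum _ fun m _ =>
    (integrable_pow_mul_exp_neg_sq_div_two _).const_mul _]
  simp_rw [integral_finsetSum (Finset.range (2 * N + 1)) fun m _ =>
    (integrable_pow_mul_exp_neg_sq_div_two _).const_mul _, integral_const_mul]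
  rw [Finset.sum_comm, Finset.mul_sum]
  symm
  refine Finset.sum_of_injOn (fun j => 2 * j) (fun a _ b _ h => by simpa using h) ?_ ?_ ?_
  · intro j hj
    simp only [Finset.coe_range, Set.mem_Iio] at hj ⊢
    omega
  · intro m hm hm'
    have : Odd m := by
      by_contra h
      rw [Nat.not_odd_iff_even, even_iff_two_dvd] at h
      obtain ⟨j, rfl⟩ := h
      refine hm' ⟨j, ?_, rfl⟩
      simp only [Finset.coe_range, Set.mem_Iio, Finset.mem_range] at hm ⊢
      omega
    refine Finset.sum_eq_zero fun r _ => ?_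
    rw [integral_odd_pow_mul_exp_neg_sq_div_two (this.add_even (even_two_mul r)), mul_zero]
  · intro j hj
    have hj' : j ≤ N := Nat.lt_succ_iff.1 (Finset.mem_range.1 hj)
    rw [stirlingCoeff, Finset.mul_sum, Finset.mul_sum]
    -- The terms with `r > 2j` vanish: `r` positive parts sum to at least `r`.
    rw [Finset.sum_subset (s₂ := Finset.range (2 * N + 1))
      (Finset.range_subset_range.2 (by omega))]
    · refine Finset.sum_congr rfl fun r _ => ?_
      rw [← mul_add, integral_even_pow_mul_exp_neg_sq_div_two, (even_two_mul j).neg_pow, pow_mul ε]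
      ring
    · intro r _ hr
      rw [partialBell_eq_zero_of_lt _ (not_lt.1 fun h => hr (Finset.mem_range.2 h))]
      simp

/-! ### From the integral to the Gamma function -/

theorem exists_abs_integral_gammaIntegrand_sub_le (N : ℕ) :
    ∃ C ≥ 0, ∀ ε : ℝ, 0 < ε → ε ≤ 1 →
      |(∫ u, gammaIntegrand ε u) -
        √(2 * Real.pi) * ∑ j ∈ Finset.range (N + 1), (ε ^ 2) ^ j * stirlingCoeff j| ≤
          C * ε ^ (2 * N + 1) := by
  obtain ⟨C, hC, h⟩ := exists_abs_gammaIntegrand_sub_le (show 0 < 2 * N + 1 by omega)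
  refine ⟨C * Real.pi, by positivity, fun ε hε hε1 => ?_⟩
  have hg : Integrable fun u : ℝ => C * ε ^ (2 * N + 1) * (1 + u ^ 2)⁻¹ :=
    integrable_inv_one_add_sq.const_mul _
  have hd : Integrable fun u => gammaIntegrand ε u - gaussianApprox (2 * N + 1) ε u :=
    hg.mono' ((measurable_gammaIntegrand ε).aestronglyMeasurable.sub
      (integrable_gaussianApprox _ ε).aestronglyMeasurable)
      (Eventually.of_forall fun u => h ε u hε hε1)
  -- Integrability comes from the approximant plus the dominated difference.
  have hi : Integrable (gammaIntegrand ε) := by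
    refine (hd.add (integrable_gaussianApprox (2 * N + 1) ε)).congr
      (Eventually.of_forall fun u => ?_)
    simp
  rw [← integral_gaussianApprox, ← integral_sub hi (integrable_gaussianApprox _ ε)]
  have hle := norm_integral_le_of_norm_le
    (f := fun u => gammaIntegrand ε u - gaussianApprox (2 * N + 1) ε u) hg
    (Eventually.of_forall fun u => h ε u hε hε1)
  refine hle.trans ?_
  rw [integral_const_mul, integral_univ_inv_one_add_sq]
  exact le_of_eq (by ring)

theorem Gamma_add_one_eq_integral_gammaIntegrand {k : ℝ} (hk : 0 < k) :
    Real.Gamma (k + 1) = k ^ k * Real.exp (-k) * √k * ∫ u, gammaIntegrand (√k)⁻¹ u := by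
  have hs : 0 < √k := Real.sqrt_pos.2 hk
  have hss : √k * √k = k := Real.mul_self_sqrt hk.le
  rw [Real.Gamma_eq_integral (by linarith), ← integral_indicator measurableSet_Ioi]
  set f : ℝ → ℝ := (Set.Ioi 0).indicator fun t => Real.exp (-t) * t ^ (k + 1 - 1)
  have h1 : ∫ t, f t = √k * ∫ u, f (k + √k * u) := by
    rw [Measure.integral_comp_mul_left (fun t => f (k + t)), integral_add_left_eq_self f k,
      abs_of_pos (inv_pos.2 hs), smul_eq_mul, mul_inv_cancel_left₀ hs.ne']
  have h2 : ∀ u, f (k + √k * u) = k ^ k * Real.exp (-k) * gammaIntegrand (√k)⁻¹ u := by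
    intro u
    have h3 : k + √k * u = k * (1 + (√k)⁻¹ * u) := by
      rw [mul_add, mul_one, ← mul_assoc]
      congr 2
      field_simp
      linarith
    have hiff : 0 < k + √k * u ↔ -1 < (√k)⁻¹ * u := by
      rw [h3, mul_pos_iff_of_pos_left hk]
      constructor <;> intro h <;> linarith
    by_cases h : -1 < (√k)⁻¹ * u
    · rw [gammaIntegrand, if_pos h,
        show f (k + √k * u) = _ from Set.indicator_of_mem (Set.mem_Ioi.2 (hiff.2 h)) _]
      have hpos : 0 < 1 + (√k)⁻¹ * u := by linarith
      rw [add_sub_cancel_right, h3, Real.mul_rpow hk.le hpos.le, Real.rpow_def_of_pos hpos,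
        mul_left_comm, mul_assoc, ← Real.exp_add, ← Real.exp_add, gammaPhase, inv_pow,
        Real.sq_sqrt hk.le, div_inv_eq_mul]
      congr 2
      ring
    · rw [gammaIntegrand, if_neg h, mul_zero]
      exact Set.indicator_of_notMem (fun h' => h (hiff.1 h')) _
  rw [h1]
  simp_rw [h2]
  rw [integral_const_mul]
  ring

theorem hasAsymptoticSeries_Gamma :
    HasAsymptoticSeries (atTop : Filter ℝ)
      (fun k : ℝ => Real.Gamma (k + 1))
      (fun k : ℝ => k ^ k * Real.exp (-k) * Real.sqrt (2 * Real.pi * k))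
      (fun k : ℝ => k)
      stirlingCoeff := by
  intro N
  obtain ⟨C, hC, h⟩ := exists_abs_integral_gammaIntegrand_sub_le N
  have hO : (fun k : ℝ => Real.Gamma (k + 1) -
        k ^ k * Real.exp (-k) * √(2 * Real.pi * k) *
          ∑ j ∈ Finset.range (N + 1), (k ^ j)⁻¹ * stirlingCoeff j)
      =O[atTop] (fun k : ℝ => k ^ k * Real.exp (-k) * √(2 * Real.pi * k) * (k ^ N)⁻¹ *
        (√k)⁻¹) := by
    refine IsBigO.of_bound C ?_
    filter_upwards [eventually_ge_atTop (1 : ℝ)] with k hk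
    have hk0 : 0 < k := by linarith
    have hs : 1 ≤ √k := Real.one_le_sqrt.2 hk
    have hb := h (√k)⁻¹ (by positivity) (inv_le_one_of_one_le₀ hs)
    have hsq : (√k)⁻¹ ^ 2 = k⁻¹ := by rw [inv_pow, Real.sq_sqrt hk0.le]
    have hpi : 1 ≤ √(2 * Real.pi) := Real.one_le_sqrt.2 (by linarith [Real.pi_gt_three])
    -- `ε^(2N+1)` splits as `k^{-N}` times `1/√k`, the spare factor that turns `O` into `o`.
    rw [pow_succ _ (2 * N), pow_mul, hsq] at hb
    simp only [inv_pow] at hb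
    have hkk : 0 < k ^ k := Real.rpow_pos_of_pos hk0 k
    rw [Gamma_add_one_eq_integral_gammaIntegrand hk0, Real.sqrt_mul (by positivity),
      Real.norm_of_nonneg (show 0 ≤ k ^ k * Real.exp (-k) * (√(2 * Real.pi) * √k) * (k ^ N)⁻¹ *
        (√k)⁻¹ by positivity), Real.norm_eq_abs]
    calc _ = |k ^ k * Real.exp (-k) * √k * ((∫ u, gammaIntegrand (√k)⁻¹ u) -
          √(2 * Real.pi) * ∑ j ∈ Finset.range (N + 1), (k ^ j)⁻¹ * stirlingCoeff j)| := by
          congr 1; ring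
      _ ≤ k ^ k * Real.exp (-k) * √k * (C * ((k ^ N)⁻¹ * (√k)⁻¹)) := by
          rw [abs_mul, abs_of_pos (by positivity)]
          gcongr
      _ = 1 * (C * (k ^ k * Real.exp (-k) * √k * (k ^ N)⁻¹ * (√k)⁻¹)) := by ring
      _ ≤ √(2 * Real.pi) * (C * (k ^ k * Real.exp (-k) * √k * (k ^ N)⁻¹ * (√k)⁻¹)) := by gcongr
      _ = _ := by ring
  refine hO.trans_isLittleO ?_
  have hlim : (fun k : ℝ => (√k)⁻¹) =o[atTop] (fun _ => (1 : ℝ)) :=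
    (isLittleO_one_iff ℝ).2 (tendsto_inv_atTop_zero.comp Real.tendsto_sqrt_atTop)
  simpa using (isBigO_refl (fun k : ℝ =>
    k ^ k * Real.exp (-k) * √(2 * Real.pi * k) * (k ^ N)⁻¹) atTop).mul_isLittleO hlim

theorem mainTheorem8 :
    HasAsymptoticSeries (Filter.atTop : Filter ℕ)
      (fun k : ℕ => (k ! : ℝ))
      (fun k : ℕ => (k : ℝ) ^ k * Real.exp (-(k : ℝ)) * Real.sqrt (2 * Real.pi * (k : ℝ)))
      (fun k : ℕ => (k : ℝ))
      stirlingCoeff ∧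
    HasAsymptoticSeries (Filter.atTop : Filter ℝ)
      (fun k : ℝ => Real.Gamma (k + 1))
      (fun k : ℝ => k ^ k * Real.exp (-k) * Real.sqrt (2 * Real.pi * k))
      (fun k : ℝ => k)
      stirlingCoeff := by
  refine ⟨fun N => ?_, hasAsymptoticSeries_Gamma⟩
  have := (hasAsymptoticSeries_Gamma N).comp_tendsto tendsto_natCast_atTop_atTop
  simpa only [Function.comp_def, Real.Gamma_nat_eq_factorial, Real.rpow_natCast] using this
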